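/- All graphs are finite and simple. An orientation of a graph $G$ is a digraph obtained by choosing exactly one of the two directions for each edge of $G$. The dichoosability (list dichromatic number) $\vec\chi_\ell(D)$ of a digraph $D$ is the least integer $k$ such that, for every assignment $L$ of a finite set $L(v)$ of at least $k$ positive integers to each vertex $v$, there is a map $\varphi$ with $\varphi(v)\in L(v)$ for every vertex $v$, such that for every integer $i$ the subdigraph of $D$ induced by $\varphi^{-1}(i)$ has no directed cycle. Theorem. (a) There is a function $\varepsilon:\mathbb N\to\mathbb R$ with $\varepsilon(d)\to 0$ as $d\to\infty$ such that every graph $G$ of minimum degree $d$ has an orientation $D$ with $$\vec\chi_\ell(D)\ \ge\ \Bigl(\tfrac13-\varepsilon(d)\Bigr)\log_2 d$$ (for $d=0$ the right-hand side is read as $0$). (b) Moreover, almost all orientations of $G$ have dichoosability $\Omega(\ln d)$: there is an absolute constant $c>0$ such that for every $\eta>0$ there is an integer $d_0$ such that, for every graph $G$ of minimum degree $d\ge d_0$, at least a $(1-\eta)$-fraction of all orientations $D$ of $G$ satisfy $\vec\chi_\ell(D)\ge c\ln d$. -/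

import Mathlib

universe u

namespace Digraph

variable {V : Type u}

/-- `D.IsOrientationOf G`: the underlying graph of `D` is `G` (two vertices are adjacent in `G` iff
they are joined by an arc of `D`, in one direction or the other), and `D` has at most one arc
between each pair of vertices. In particular `D` has no loops. -/
structure IsOrientationOf (D : Digraph V) (G : SimpleGraph V) : Prop where
  adj_iff : ∀ u v : V, G.Adj u v ↔ D.Adj u v ∨ D.Adj v u
  not_both : ∀ u v : V, ¬ (D.Adj u v ∧ D.Adj v u)

/-- The subdigraph of `D` induced by the vertex set `S`, as a digraph on the subtype `S`. -/
def inducedOn (D : Digraph V) (S : Set V) : Digraph S where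
  Adj u v := D.Adj u v

/-- A digraph is acyclic if it has no directed cycle. The transitive closure of the arc relation
relates `v` to itself iff there is a closed directed walk of positive length through `v`; such a
walk exists for some `v` iff there is a directed cycle. -/
def IsAcyclic (D : Digraph V) : Prop :=
  ∀ v : V, ¬ Relation.TransGen D.Adj v v

/-- A dicolouring of `D`: a function from the vertices to the positive integers such that every
colour class induces an acyclic digraph. -/
def IsDicolouring (D : Digraph V) (φ : V → ℕ+) : Prop :=
  ∀ i : ℕ+, (D.inducedOn {v | φ v = i}).IsAcyclic

/-- For every `k`-list assignment `L` (each vertex receives a finite set of at least `k` positive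
integers), `D` admits an `L`-dicolouring. -/
def IsDichoosable (D : Digraph V) (k : ℕ) : Prop :=
  ∀ L : V → Finset ℕ+, (∀ v, k ≤ (L v).card) →
    ∃ φ : V → ℕ+, (∀ v, φ v ∈ L v) ∧ D.IsDicolouring φ

/-- The dichoosability (list dichromatic number) of `D`: the least `k` such that `D` admits an
`L`-dicolouring for every `k`-list assignment `L`. -/
noncomputable def dichoosability (D : Digraph V) : ℕ :=
  sInf {k : ℕ | D.IsDichoosable k}

/-- The minimum in the definition of the dichoosability is attained for every loopless digraph on
a finite vertex set. -/
theorem isDichoosable_dichoosability [Fintype V] (D : Digraph V) (hD : ∀ v, ¬ D.Adj v v) :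
    D.IsDichoosable D.dichoosability := by
  classical
  refine Nat.sInf_mem (s := {k : ℕ | D.IsDichoosable k}) ⟨Fintype.card V, ?_⟩
  intro L hL
  obtain ⟨φ, hinj, hφ⟩ := (Finset.all_card_le_biUnion_card_iff_exists_injective L).1 (by
    intro s
    rcases s.eq_empty_or_nonempty with rfl | ⟨v, hv⟩
    · simp
    · exact (Finset.card_le_univ s).trans
        ((hL v).trans (Finset.card_le_card (Finset.subset_biUnion_of_mem L hv))))
  refine ⟨φ, hφ, ?_⟩
  intro i v hv
  obtain ⟨w, hw, -⟩ := Relation.TransGen.head'_iff.1 hv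
  have hvw : (v : V) = w := hinj (v.2.trans w.2.symm)
  have h2 : D.Adj (v : V) (w : V) := hw
  rw [← hvw] at h2
  exact hD _ h2

end Digraph

/-! Both parts follow from one statement: if the minimum degree `d` of `G` is at least `2 ^ 21 * 8 ^
k * (k + 1) ^ 5`, all but a `2 ^ (-d)` fraction of the orientations have dichoosability above `k`.
Two facts are combined; write `n` for the number of vertices.

An orientation acyclic along a subgraph `H` is determined there by its outdegrees, so a random
orientation is acyclic along `H` with probability at most `∏ (deg_H v + 1) / 2 ^ e(H)`, which is at
most `4 ^ (-n)` once `e(H) ≥ 7 n`. A union bound over the `2 ^ n` vertex sets shows that in almost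
all orientations every acyclic set spans fewer than `7 n` edges
(`ncard_exists_isAcyclic_dense_mul_le`).

On the other hand some `k`-list assignment, depending on `G` only, forces a colour class spanning at
least `7 n` edges in every list colouring (`exists_lists_forall_exists_dense`). Random lists from a
palette of `2 t` colours are first given to a sparse random set `B`. Around most vertices every half
of the palette contains the lists of many neighbours in `B`, so under any colouring of `B` at least
half of the colours occur `r` times there. Since `B` has few colourings, lists outside `B` can be
chosen so that, for each of them, many vertices have only such frequent colours in their list.
Whatever colour such a vertex takes, it gains `r` monochromatic edges, and some colour collects `7
n` of them.

The sparsity of `B`, the chance that a list falls into a given half, and `r` each cost a factor `2 ^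
k` up to polynomials in `k`: hence `8 ^ k` and the constant `1/3`. -/

/-! ### Acyclic orientations and their outdegrees -/

namespace Digraph

variable {V : Type u}

/-- The digraph obtained from `D` by reversing every arc whose underlying edge lies in `F`. -/
def reverseOn (D : Digraph V) (F : Finset (Sym2 V)) : Digraph V where
  Adj u v := (s(u, v) ∈ F ∧ D.Adj v u) ∨ (s(u, v) ∉ F ∧ D.Adj u v)

theorem IsOrientationOf.reverseOn {D : Digraph V} {G : SimpleGraph V} (h : D.IsOrientationOf G)
    (F : Finset (Sym2 V)) : (D.reverseOn F).IsOrientationOf G where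
  adj_iff u v := by
    have := h.adj_iff u v
    simp only [Digraph.reverseOn, Sym2.eq_swap (a := v) (b := u)]
    tauto
  not_both u v := by
    have := h.not_both u v
    simp only [Digraph.reverseOn, Sym2.eq_swap (a := v) (b := u)]
    tauto

theorem exists_isOrientationOf (G : SimpleGraph V) : ∃ D : Digraph V, D.IsOrientationOf G := by
  refine ⟨⟨fun u v => G.Adj u v ∧ WellOrderingRel u v⟩, ⟨fun u v => ?_, fun u v => ?_⟩⟩
  · constructor
    · intro h
      rcases trichotomous_of WellOrderingRel u v with h1 | h1 | h1
      · exact Or.inl ⟨h, h1⟩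
      · exact absurd h1 h.ne
      · exact Or.inr ⟨h.symm, h1⟩
    · rintro (h | h)
      · exact h.1
      · exact h.1.symm
  · rintro ⟨h1, h2⟩
    exact asymm_of WellOrderingRel h1.2 h2.2

/-- The digraph `D` has no directed cycle all of whose arcs are edges of `H`. -/
def IsAcyclicAlong (D : Digraph V) (H : SimpleGraph V) : Prop :=
  ∀ v, ¬ Relation.TransGen (fun u w => H.Adj u w ∧ D.Adj u w) v v

open Classical in
/-- The number of arcs of `D` along edges of `H` that leave `v`. -/
noncomputable def outdegreeAlong [Fintype V] (D : Digraph V) (H : SimpleGraph V) (v : V) : ℕ :=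
  (Finset.univ.filter fun w => H.Adj v w ∧ D.Adj v w).card

/-- An orientation that is acyclic along `H` is determined along `H` by its outdegrees. -/
theorem IsOrientationOf.eq_of_outdegreeAlong_eq [Fintype V] {D D' : Digraph V}
    {G H : SimpleGraph V} (hD : D.IsOrientationOf G) (hD' : D'.IsOrientationOf G) (hHG : H ≤ G)
    (hout : ∀ u v, ¬ H.Adj u v → (D.Adj u v ↔ D'.Adj u v)) (hac : D.IsAcyclicAlong H)
    (hdeg : D.outdegreeAlong H = D'.outdegreeAlong H) : D = D' := by
  classical
  -- If all `D`-out-neighbours of `v` along `H` were `D'`-out-neighbours, equal outdegrees would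
  -- make the two sets coincide, yet `D'` has the arc from `v` to `u`. So a reversed arc into `v`
  -- forces a reversed arc out of `v`.
  have step : ∀ u v, H.Adj u v → D.Adj u v → ¬ D'.Adj u v →
      ∃ w, H.Adj v w ∧ D.Adj v w ∧ ¬ D'.Adj v w := by
    intro u v hH h1 h2
    by_contra! hc
    have hsub : (Finset.univ.filter fun w => H.Adj v w ∧ D.Adj v w) ⊆
        (Finset.univ.filter fun w => H.Adj v w ∧ D'.Adj v w) := by
      intro w hw
      simp only [Finset.mem_filter, Finset.mem_univ, true_and] at hw ⊢
      exact ⟨hw.1, hc w hw.1 hw.2⟩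
    have heq := Finset.eq_of_subset_of_card_le hsub (congrFun hdeg v).ge
    have hvu : D'.Adj v u := ((hD'.adj_iff u v).1 (hHG hH)).resolve_left h2
    have : u ∈ (Finset.univ.filter fun w => H.Adj v w ∧ D.Adj v w) := by
      rw [heq]; simp [hH.symm, hvu]
    simp only [Finset.mem_filter, Finset.mem_univ, true_and] at this
    exact hD.not_both u v ⟨h1, this.2⟩
  -- Reversed arcs would continue forever along a walk of `D`, which acyclicity and finiteness
  -- exclude. Vertices reachable from `v` lie below `v` in `r`, so the induction starts at the
  -- sinks.
  let r : V → V → Prop := fun u w => Relation.TransGen (fun u w => H.Adj u w ∧ D.Adj u w) w u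
  have : Std.Irrefl r := ⟨hac⟩
  have : IsTrans V r := ⟨fun a b c h1 h2 => Relation.TransGen.trans h2 h1⟩
  have hwf : WellFounded r := Finite.wellFounded_of_trans_of_irrefl r
  have none : ∀ v u, H.Adj u v → D.Adj u v → D'.Adj u v := by
    intro v
    induction v using hwf.induction with
    | _ v ih =>
      intro u hH h1
      by_contra h2
      obtain ⟨w, hw, hw1, hw2⟩ := step u v hH h1 h2
      exact hw2 (ih w (Relation.TransGen.single ⟨hw, hw1⟩) v hw hw1)
  ext u v
  by_cases hH : H.Adj u v
  · refine ⟨none v u hH, fun h => ?_⟩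
    rcases (hD.adj_iff u v).1 (hHG hH) with h1 | h1
    · exact h1
    · exact absurd ⟨h, none u v hH.symm h1⟩ (hD'.not_both u v)
  · exact hout u v hH

instance [Finite V] : Finite (Digraph V) :=
  Finite.of_injective (fun D : Digraph V => D.Adj) fun _ _ h => Digraph.ext h

open Classical in
-- Reversing `D` on a set `F` of edges of `H`, while recording the outdegrees of `D`, loses nothing:
-- off `H` the orientation is still visible, on `H` the outdegrees recover it, and `F` is where it
-- differs from its reversal.
theorem ncard_isAcyclicAlong_mul_le [Fintype V] {G H : SimpleGraph V} (hHG : H ≤ G) :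
    {D : Digraph V | D.IsOrientationOf G ∧ D.IsAcyclicAlong H}.ncard * 2 ^ H.edgeFinset.card ≤
      {D : Digraph V | D.IsOrientationOf G}.ncard * ∏ v, (H.degree v + 1) := by
  let _ : Fintype (Digraph V) := Fintype.ofFinite _
  rw [Set.ncard_eq_toFinset_card', Set.ncard_eq_toFinset_card', ← Finset.card_powerset]
  have : ∏ v, (H.degree v + 1) =
      (Fintype.piFinset fun v => Finset.range (H.degree v + 1)).card := by simp
  rw [this, ← Finset.card_product, ← Finset.card_product]
  refine Finset.card_le_card_of_injOn
    (fun p => (p.1.reverseOn p.2, p.1.outdegreeAlong H)) ?_ ?_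
  · rintro ⟨D, F⟩ hp
    simp only [Finset.coe_product, Set.mem_prod, Finset.mem_coe, Set.mem_toFinset,
      Set.mem_ofPred_eq] at hp ⊢
    refine ⟨hp.1.1.reverseOn F, ?_⟩
    simp only [Fintype.mem_piFinset, Finset.mem_range, Nat.lt_succ_iff]
    intro v
    rw [← SimpleGraph.card_neighborFinset_eq_degree]
    refine Finset.card_le_card fun w hw => ?_
    simp only [Finset.mem_filter, Finset.mem_univ, true_and] at hw
    simpa using hw.1
  · rintro ⟨D, F⟩ hp ⟨D', F'⟩ hp' heq
    simp only [Finset.coe_product, Set.mem_prod, Finset.mem_coe, Set.mem_toFinset,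
      Set.mem_ofPred_eq, Finset.mem_powerset] at hp hp'
    obtain ⟨⟨hD, hac⟩, hF⟩ := hp
    obtain ⟨⟨hD', -⟩, hF'⟩ := hp'
    simp only [Prod.mk.injEq] at heq
    have hadj : ∀ u v, (D.reverseOn F).Adj u v ↔ (D'.reverseOn F').Adj u v := by
      intro u v; rw [heq.1]
    simp only [Digraph.reverseOn] at hadj
    have hDD : D = D' := by
      refine hD.eq_of_outdegreeAlong_eq hD' hHG (fun u v huv => ?_) hac heq.2
      have h1 : s(u, v) ∉ F := fun h => huv (by simpa using hF h)
      have h2 : s(u, v) ∉ F' := fun h => huv (by simpa using hF' h)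
      simpa [h1, h2] using hadj u v
    subst hDD
    refine Prod.ext rfl ?_
    ext e
    induction e with
    | _ u v =>
      by_cases hG : G.Adj u v
      · have h1 := (hD.adj_iff u v).1 hG
        have h2 := hD.not_both u v
        have h3 := hadj u v
        tauto
      · have h1 : s(u, v) ∉ F := fun h => hG (hHG (by simpa using hF h))
        have h2 : s(u, v) ∉ F' := fun h => hG (hHG (by simpa using hF' h))
        simp [h1, h2]

/-! ### Acyclic sets span few edges in most orientations -/

theorem succ_pow_four_le (x : ℕ) : (x + 1) ^ 4 ≤ 64 * 2 ^ x := by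
  rcases Nat.lt_or_ge x 6 with h | h
  · interval_cases x <;> norm_num
  · induction x, h using Nat.le_induction with
    | base => norm_num
    | succ y hy ih =>
      have h6 : (y + 1 + 1) ^ 4 ≤ 2 * (y + 1) ^ 4 := by
        obtain ⟨z, rfl⟩ := Nat.exists_eq_add_of_le hy
        nlinarith [sq_nonneg z, Nat.zero_le (z ^ 3), Nat.zero_le (z ^ 4), Nat.zero_le (z ^ 2)]
      rw [pow_succ 2 y]
      omega

open Classical in
-- In fourth powers the right side is `2 ^ (4 e)` and the degrees contribute `2 ^ (2 e)`. The slack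
-- `2 e` must cover 6 per vertex from `64 = 2 ^ 6` and 8 per vertex from `2 ^ (2 n)`, hence the 7.
theorem prod_degree_succ_mul_le [Fintype V] (H : SimpleGraph V)
    (hH : 7 * Fintype.card V ≤ H.edgeFinset.card) :
    (∏ v, (H.degree v + 1)) * 2 ^ (2 * Fintype.card V) ≤ 2 ^ H.edgeFinset.card := by
  refine le_of_pow_le_pow_left₀ (n := 4) (by norm_num) (by positivity) ?_
  have h1 : (∏ v, (H.degree v + 1)) ^ 4 ≤ 64 ^ Fintype.card V * 2 ^ (2 * H.edgeFinset.card) := by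
    rw [← H.sum_degrees_eq_twice_card_edges, ← Finset.prod_pow, ← Finset.prod_pow_eq_pow_sum]
    have : (64 : ℕ) ^ Fintype.card V = ∏ _v : V, 64 := by simp
    rw [this, ← Finset.prod_mul_distrib]
    exact Finset.prod_le_prod' fun v _ => succ_pow_four_le _
  calc ((∏ v, (H.degree v + 1)) * 2 ^ (2 * Fintype.card V)) ^ 4
      = (∏ v, (H.degree v + 1)) ^ 4 * 2 ^ (8 * Fintype.card V) := by
        rw [mul_pow, ← pow_mul]; ring_nf
    _ ≤ 64 ^ Fintype.card V * 2 ^ (2 * H.edgeFinset.card) * 2 ^ (8 * Fintype.card V) := by gcongr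
    _ = 2 ^ (14 * Fintype.card V + 2 * H.edgeFinset.card) := by
        rw [show (64 : ℕ) = 2 ^ 6 by norm_num, ← pow_mul, ← pow_add, ← pow_add]; ring_nf
    _ ≤ 2 ^ (H.edgeFinset.card * 4) := Nat.pow_le_pow_right (by norm_num) (by omega)
    _ = (2 ^ H.edgeFinset.card) ^ 4 := by rw [pow_mul]

/-- The edges of `G` inside `S`, as a graph on the whole vertex set. -/
def _root_.SimpleGraph.within (G : SimpleGraph V) (S : Set V) : SimpleGraph V where
  Adj u v := G.Adj u v ∧ u ∈ S ∧ v ∈ S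
  symm := ⟨fun _ _ h => ⟨h.1.symm, h.2.2, h.2.1⟩⟩
  loopless := ⟨fun _ h => h.1.ne rfl⟩

theorem IsAcyclic.isAcyclicAlong_within {D : Digraph V} {S : Set V}
    (h : (D.inducedOn S).IsAcyclic) (G : SimpleGraph V) : D.IsAcyclicAlong (G.within S) := by
  have key : ∀ u v, Relation.TransGen (fun u w => (G.within S).Adj u w ∧ D.Adj u w) u v →
      ∃ (hu : u ∈ S) (hv : v ∈ S), Relation.TransGen (D.inducedOn S).Adj ⟨u, hu⟩ ⟨v, hv⟩ := by
    intro u v huv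
    induction huv with
    | single h => exact ⟨h.1.2.1, h.1.2.2, .single h.2⟩
    | tail _ h ih =>
      obtain ⟨hu, hv, ht⟩ := ih
      exact ⟨hu, h.1.2.2, ht.tail h.2⟩
  intro v hv
  obtain ⟨h1, _, h2⟩ := key v v hv
  exact h _ h2

open Classical in
/-- In almost all orientations of `G`, every acyclic set of vertices spans few edges. -/
theorem ncard_exists_isAcyclic_dense_mul_le [Fintype V] (G : SimpleGraph V) :
    {D : Digraph V | D.IsOrientationOf G ∧ ∃ S : Set V, (D.inducedOn S).IsAcyclic ∧
        7 * Fintype.card V ≤ (G.within S).edgeFinset.card}.ncard * 2 ^ Fintype.card V ≤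
      {D : Digraph V | D.IsOrientationOf G}.ncard := by
  set n := Fintype.card V
  set N := {D : Digraph V | D.IsOrientationOf G}.ncard
  -- Half of the factor `2 ^ (2 * n)` pays for the union bound over all `S`.
  have hS : ∀ S : Finset V, {D : Digraph V | D.IsOrientationOf G ∧ (D.inducedOn S).IsAcyclic ∧
      7 * n ≤ (G.within S).edgeFinset.card}.ncard * 2 ^ (2 * n) ≤ N := by
    intro S
    by_cases h7 : 7 * n ≤ (G.within S).edgeFinset.card
    · have hle : G.within S ≤ G := fun _ _ h => h.1
      have h1 := ncard_isAcyclicAlong_mul_le hle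
      have h2 := prod_degree_succ_mul_le _ h7
      have h3 : {D : Digraph V | D.IsOrientationOf G ∧ (D.inducedOn S).IsAcyclic ∧
          7 * n ≤ (G.within S).edgeFinset.card}.ncard ≤
          {D : Digraph V | D.IsOrientationOf G ∧ D.IsAcyclicAlong (G.within S)}.ncard :=
        Set.ncard_le_ncard (fun D hD => ⟨hD.1, hD.2.1.isAcyclicAlong_within G⟩) (Set.toFinite _)
      refine le_of_mul_le_mul_right ?_ (show 0 < 2 ^ (G.within S).edgeFinset.card by positivity)
      calc _ ≤ {D : Digraph V | D.IsOrientationOf G ∧ D.IsAcyclicAlong (G.within S)}.ncard *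
            2 ^ (2 * n) * 2 ^ (G.within S).edgeFinset.card := by gcongr
        _ = {D : Digraph V | D.IsOrientationOf G ∧ D.IsAcyclicAlong (G.within S)}.ncard *
            2 ^ (G.within S).edgeFinset.card * 2 ^ (2 * n) := by ring
        _ ≤ (N * ∏ v, ((G.within S).degree v + 1)) * 2 ^ (2 * n) := by gcongr
        _ = N * ((∏ v, ((G.within S).degree v + 1)) * 2 ^ (2 * n)) := by ring
        _ ≤ _ := by gcongr
    · simp [h7]
  refine le_of_mul_le_mul_right ?_ (show 0 < 2 ^ n by positivity)
  have hU : {D : Digraph V | D.IsOrientationOf G ∧ ∃ S : Set V, (D.inducedOn S).IsAcyclic ∧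
        7 * n ≤ (G.within S).edgeFinset.card} ⊆ ⋃ S ∈ (Finset.univ : Finset (Finset V)),
      {D : Digraph V | D.IsOrientationOf G ∧ (D.inducedOn S).IsAcyclic ∧
        7 * n ≤ (G.within S).edgeFinset.card} := by
    rintro D ⟨hD, S, h1, h2⟩
    simp only [Finset.mem_univ, Set.iUnion_true, Set.mem_iUnion]
    refine ⟨S.toFinset, hD, ?_⟩
    have : ((S.toFinset : Finset V) : Set V) = S := by simp
    rw [this]
    exact ⟨h1, by convert h2⟩
  calc _ = {D : Digraph V | D.IsOrientationOf G ∧ ∃ S : Set V, (D.inducedOn S).IsAcyclic ∧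
        7 * n ≤ (G.within S).edgeFinset.card}.ncard * 2 ^ (2 * n) := by
        rw [mul_assoc, ← pow_add, two_mul]
    _ ≤ (∑ S : Finset V, {D : Digraph V | D.IsOrientationOf G ∧ (D.inducedOn S).IsAcyclic ∧
        7 * n ≤ (G.within S).edgeFinset.card}.ncard) * 2 ^ (2 * n) := by
        gcongr
        exact (Set.ncard_le_ncard hU (Set.toFinite _)).trans (Finset.set_ncard_biUnion_le _ _)
    _ ≤ ∑ _S : Finset V, N := by
        rw [Finset.sum_mul]; exact Finset.sum_le_sum fun S _ => hS S
    _ = N * 2 ^ n := by simp [n, mul_comm]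

end Digraph

/-! ### Binomial and exponential moment estimates -/

/-- The falling factorial of `t` is at least `t ^ k * (1 - k / t) ^ k`, and Bernoulli's inequality
bounds the last factor below by `1 - k ^ 2 / t ≥ 1 / 2`. -/
theorem Nat.choose_two_mul_le {k t : ℕ} (h : 2 * k ^ 2 ≤ t) :
    (2 * t).choose k ≤ 2 ^ (k + 1) * t.choose k := by
  rcases Nat.eq_zero_or_pos t with rfl | ht
  · have : k = 0 := by nlinarith
    subst this; simp
  have hkt : k ≤ t := by nlinarith
  have h1 : t ^ k ≤ 2 * t.descFactorial k := by
    have h2 : (t + 1 - k) ^ k ≤ t.descFactorial k := Nat.pow_sub_le_descFactorial t k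
    have h3 : (t : ℝ) ^ k ≤ 2 * ((t + 1 - k : ℕ) : ℝ) ^ k := by
      have ht' : (0 : ℝ) < t := by exact_mod_cast ht
      have hk' : (k : ℝ) ≤ t := by exact_mod_cast hkt
      have hb := one_add_mul_le_pow (a := -(k / t : ℝ))
        (by have : (k / t : ℝ) ≤ 1 := (div_le_one ht').2 hk'
            linarith) k
      have hh : (1 : ℝ) / 2 ≤ 1 + k * -(k / t) := by
        have : (k * (k / t) : ℝ) ≤ 1 / 2 := by
          rw [← mul_div_assoc, div_le_iff₀ ht']
          have : (2 * k ^ 2 : ℝ) ≤ t := by exact_mod_cast h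
          nlinarith
        linarith
      have h4 : ((t : ℝ) * (1 + -(k / t))) ^ k ≤ ((t + 1 - k : ℕ) : ℝ) ^ k := by
        have he : (t : ℝ) * (1 + -(k / t)) = t - k := by field_simp; ring
        rw [he]
        refine pow_le_pow_left₀ (by linarith) ?_ k
        rw [Nat.cast_sub (by omega)]; push_cast; linarith
      rw [mul_pow] at h4
      have := mul_le_mul_of_nonneg_left (hh.trans hb) (pow_nonneg ht'.le k)
      linarith
    have h3' : t ^ k ≤ 2 * (t + 1 - k) ^ k := by exact_mod_cast h3
    omega
  refine le_of_mul_le_mul_left ?_ (Nat.factorial_pos k)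
  calc k.factorial * (2 * t).choose k = (2 * t).descFactorial k :=
        (Nat.descFactorial_eq_factorial_mul_choose _ _).symm
    _ ≤ (2 * t) ^ k := Nat.descFactorial_le_pow _ _
    _ = 2 ^ k * t ^ k := mul_pow ..
    _ ≤ 2 ^ k * (2 * t.descFactorial k) := by gcongr
    _ = _ := by rw [Nat.descFactorial_eq_factorial_mul_choose]; ring

section Sampling

variable {V : Type u} [Fintype V] [DecidableEq V] {β : Type*}

/-- This plays the role of a Chernoff bound. The coordinates are independent, so the sum factors,
and each `u ∈ U` contributes a mean of at most `1 - x / 2 ≤ exp (-(x / 2))`. -/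
theorem sum_half_pow_card_filter_le (Ω : Finset β) (U : Finset V) (A : V → β → Prop)
    [∀ v, DecidablePred (A v)] {x : ℝ}
    (hx : ∀ u ∈ U, x * Ω.card ≤ (Ω.filter (A u)).card) :
    ∑ ω ∈ Fintype.piFinset fun _ : V => Ω, (1 / 2 : ℝ) ^ (U.filter fun u => A u (ω u)).card ≤
      (Fintype.piFinset fun _ : V => Ω).card * Real.exp (-(x / 2 * U.card)) := by
  have h1 : ∀ ω : V → β, (1 / 2 : ℝ) ^ (U.filter fun u => A u (ω u)).card =
      ∏ v, if v ∈ U ∧ A v (ω v) then (1 / 2 : ℝ) else 1 := by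
    intro ω
    rw [← Finset.prod_filter, Finset.prod_const]
    congr 2
    ext v; simp
  simp_rw [h1]
  rw [← Finset.prod_univ_sum (fun _ : V => Ω)
    (fun v b => if v ∈ U ∧ A v b then (1 / 2 : ℝ) else 1)]
  have h2 : ∀ v, ∑ b ∈ Ω, (if v ∈ U ∧ A v b then (1 / 2 : ℝ) else 1) ≤
      Ω.card * (if v ∈ U then Real.exp (-(x / 2)) else 1) := by
    intro v
    by_cases hv : v ∈ U
    · simp only [hv, true_and, if_true]
      have h3 : ∑ b ∈ Ω, (if A v b then (1 / 2 : ℝ) else 1) =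
          Ω.card - 1 / 2 * (Ω.filter (A v)).card := by
        have : ∀ b ∈ Ω, (if A v b then (1 / 2 : ℝ) else 1) = 1 - if A v b then 1 / 2 else 0 := by
          intro b _; split_ifs <;> norm_num
        rw [Finset.sum_congr rfl this, Finset.sum_sub_distrib, ← Finset.sum_filter]
        simp [mul_comm]
      rw [h3]
      have h4 := Real.add_one_le_exp (-(x / 2))
      have h5 := mul_le_mul_of_nonneg_left h4 (Nat.cast_nonneg (α := ℝ) Ω.card)
      have := hx v hv
      linarith
    · simp [hv]
  refine (Finset.prod_le_prod (fun v _ => Finset.sum_nonneg fun b _ => ?_)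
    fun v _ => h2 v).trans (le_of_eq ?_)
  · split_ifs <;> norm_num
  · rw [Finset.prod_mul_distrib, Finset.prod_ite_mem, Finset.univ_inter, Finset.prod_const,
      Finset.prod_const, ← Real.exp_nat_mul]
    simp only [Fintype.card_piFinset, Finset.prod_const, Nat.cast_pow]
    congr 2; ring

theorem card_filter_piFinset_mul_card (Ω : Finset β) (p : β → Prop) [DecidablePred p] (v : V) :
    ((Fintype.piFinset fun _ : V => Ω).filter fun ω => p (ω v)).card * Ω.card =
      (Fintype.piFinset fun _ : V => Ω).card * (Ω.filter p).card := by
  have h : ((Fintype.piFinset fun _ : V => Ω).filter fun ω => p (ω v)) =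
      Fintype.piFinset fun u => if u = v then Ω.filter p else Ω := by
    ext ω
    simp only [Finset.mem_filter, Fintype.mem_piFinset]
    constructor
    · rintro ⟨h1, h2⟩ u
      split_ifs with huv
      · subst huv; simp [h1, h2]
      · exact h1 u
    · intro h
      refine ⟨fun u => ?_, ?_⟩
      · have := h u
        split_ifs at this with huv
        · exact (Finset.mem_filter.1 this).1
        · exact this
      · have := h v
        rw [if_pos rfl] at this
        exact (Finset.mem_filter.1 this).2
  rw [h, Fintype.card_piFinset, Fintype.card_piFinset,
    ← Finset.mul_prod_erase _ _ (Finset.mem_univ v),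
    ← Finset.mul_prod_erase Finset.univ (fun _ : V => Ω.card) (Finset.mem_univ v)]
  have : ∏ u ∈ Finset.univ.erase v, (if u = v then Ω.filter p else Ω).card =
      ∏ u ∈ Finset.univ.erase v, Ω.card := by
    refine Finset.prod_congr rfl fun u hu => ?_
    rw [if_neg (Finset.ne_of_mem_erase hu)]
  rw [this, if_pos rfl]
  ring

end Sampling

theorem card_filter_subset_powersetCard {α : Type*} [DecidableEq α] {P T : Finset α} (hT : T ⊆ P)
    (k : ℕ) : ((P.powersetCard k).filter (· ⊆ T)).card = T.card.choose k := by
  rw [← Finset.card_powersetCard]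
  congr 1
  ext A
  simp only [Finset.mem_filter, Finset.mem_powersetCard]
  exact ⟨fun h => ⟨h.2, h.1.2⟩, fun h => ⟨⟨h.1.trans hT, h.2⟩, h.1⟩⟩

theorem card_le_two_pow_mul_card_filter_subset {α : Type*} [DecidableEq α] {P T : Finset α}
    {k t : ℕ} (hT : T ⊆ P) (hP : P.card = 2 * t) (hkt : 2 * k ^ 2 ≤ t) (hTt : t ≤ T.card) :
    (P.powersetCard k).card ≤ 2 ^ (k + 1) * ((P.powersetCard k).filter (· ⊆ T)).card := by
  rw [card_filter_subset_powersetCard hT, Finset.card_powersetCard, hP]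
  exact (Nat.choose_two_mul_le hkt).trans (by gcongr)

theorem exp_neg_natCast_le (n : ℕ) : Real.exp (-n) ≤ (1 / 2 : ℝ) ^ n := by
  have h2 : (2 : ℝ) ≤ Real.exp 1 := by have := Real.add_one_le_exp (1 : ℝ); linarith
  rw [Real.exp_neg, one_div, inv_pow, ← Real.exp_one_pow]
  gcongr

/-! ### Random lists forcing a dense colour class -/

namespace SimpleGraph

variable {V : Type u} [Fintype V] [DecidableEq V] {α : Type*} [DecidableEq α]

/-- There are a small set `B` and lists such that, for most vertices `v`, every half `T` of the
palette contains the lists of many neighbours of `v` in `B`. -/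
theorem exists_sample (G : SimpleGraph V) [DecidableRel G.Adj] {P : Finset α} {k t m M : ℕ}
    (hP : P.card = 2 * t) (hkt : 2 * k ^ 2 ≤ t) (hm : 0 < m)
    (hG : ∀ v, m * 2 ^ (k + 2) * (M + 2 * t + 2) ≤ G.degree v) :
    ∃ (B : Finset V) (L : V → Finset α), (∀ v, L v ∈ P.powersetCard k) ∧
      m * B.card ≤ 2 * Fintype.card V ∧
      2 * (Finset.univ.filter fun v => ∃ T ∈ P.powersetCard t,
        ((G.neighborFinset v).filter fun u => u ∈ B ∧ L u ⊆ T).card < M).card ≤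
          Fintype.card V := by
  set n := Fintype.card V with hn
  -- Each vertex draws a number below `m` and, independently, a list; it belongs to `B` when the
  -- number is 0, so with probability `1 / m`.
  set Ω : Finset (ℕ × Finset α) := Finset.range m ×ˢ P.powersetCard k with hΩ
  set Ωs : Finset (V → ℕ × Finset α) := Fintype.piFinset fun _ : V => Ω with hΩs
  have hk2t : k ≤ 2 * t := by nlinarith
  have hΩ0 : Ω.Nonempty := by
    rw [hΩ, Finset.nonempty_product]
    exact ⟨Finset.nonempty_range_iff.2 hm.ne',
      Finset.powersetCard_nonempty.2 (by omega)⟩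
  have hΩs0 : Ωs.Nonempty := by
    rw [hΩs, Fintype.piFinset_nonempty]; exact fun _ => hΩ0
  have hΩc : Ω.card = m * (P.powersetCard k).card := by simp [hΩ]
  let X : V → Finset α → (V → ℕ × Finset α) → ℕ := fun v T ω =>
    ((G.neighborFinset v).filter fun u => (ω u).1 = 0 ∧ (ω u).2 ⊆ T).card
  let Z : (V → ℕ × Finset α) → ℕ := fun ω => (Finset.univ.filter fun v => (ω v).1 = 0).card
  have hmpos : (0 : ℝ) < m := by exact_mod_cast hm
  have hX : ∀ v, ∀ T ∈ P.powersetCard t,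
      ∑ ω ∈ Ωs, (1 / 2 : ℝ) ^ X v T ω ≤ Ωs.card * (1 / 2) ^ (M + 2 * t + 2) := by
    intro v T hT
    obtain ⟨hTP, hTt⟩ := Finset.mem_powersetCard.1 hT
    have hA : (Ω.filter fun b => b.1 = 0 ∧ b.2 ⊆ T).card =
        ((P.powersetCard k).filter (· ⊆ T)).card := by
      rw [hΩ, Finset.filter_product (fun a : ℕ => a = 0) (fun A : Finset α => A ⊆ T),
        Finset.card_product]
      have : (Finset.range m).filter (fun a => a = 0) = {0} := by
        ext a; simp only [Finset.mem_filter, Finset.mem_range, Finset.mem_singleton]; omega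
      rw [this]; simp
    have h1 := sum_half_pow_card_filter_le Ω (G.neighborFinset v)
      (fun _ b => b.1 = 0 ∧ b.2 ⊆ T) (x := 1 / (m * 2 ^ (k + 1))) (by
        intro u _
        rw [hA, hΩc, div_mul_eq_mul_div, one_mul, div_le_iff₀ (by positivity)]
        have := card_le_two_pow_mul_card_filter_subset hTP hP hkt hTt.ge
        have h' : ((P.powersetCard k).card : ℝ) ≤
            2 ^ (k + 1) * ((P.powersetCard k).filter (· ⊆ T)).card := by exact_mod_cast this
        push_cast
        have := mul_le_mul_of_nonneg_left h' hmpos.le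
        linarith)
    refine h1.trans (mul_le_mul_of_nonneg_left ?_ (Nat.cast_nonneg _))
    refine le_trans ?_ (exp_neg_natCast_le (M + 2 * t + 2))
    rw [Real.exp_le_exp, neg_le_neg_iff, card_neighborFinset_eq_degree]
    have h2 : ((m * 2 ^ (k + 2) * (M + 2 * t + 2) : ℕ) : ℝ) ≤ G.degree v := by
      exact_mod_cast hG v
    rw [div_div, div_mul_eq_mul_div, one_mul, le_div_iff₀ (by positivity)]
    refine le_trans (le_of_eq ?_) h2
    push_cast; ring
  have hZ : (m : ℝ) * ∑ ω ∈ Ωs, (Z ω : ℝ) = Ωs.card * n := by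
    have h1 : ∀ v : V, m * (Ωs.filter fun ω => (ω v).1 = 0).card = Ωs.card := by
      intro v
      have h2 := card_filter_piFinset_mul_card Ω (fun b => b.1 = 0) v
      have h3 : (Ω.filter fun b => b.1 = 0).card = (P.powersetCard k).card := by
        rw [hΩ]
        have : (Finset.range m ×ˢ P.powersetCard k).filter (fun b => b.1 = 0) =
            {0} ×ˢ P.powersetCard k := by
          ext ⟨a, A⟩
          simp only [Finset.mem_filter, Finset.mem_product, Finset.mem_range,
            Finset.mem_singleton]
          constructor
          · rintro ⟨h, h'⟩; exact ⟨h', h.2⟩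
          · rintro ⟨rfl, h⟩; exact ⟨⟨hm, h⟩, rfl⟩
        rw [this]; simp
      rw [h3, hΩc] at h2
      refine Nat.eq_of_mul_eq_mul_right (m := (P.powersetCard k).card)
        (Finset.card_pos.2 (Finset.powersetCard_nonempty.2 (by omega))) ?_
      rw [← h2]; ring
    have h2 : ∑ ω ∈ Ωs, Z ω = ∑ v : V, (Ωs.filter fun ω => (ω v).1 = 0).card := by
      simp only [Z, Finset.card_filter]
      rw [Finset.sum_comm]
    have h3 : m * ∑ ω ∈ Ωs, Z ω = Ωs.card * n := by
      rw [h2, Finset.mul_sum, Finset.sum_congr rfl fun v _ => h1 v]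
      simp [hn, mul_comm]
    exact_mod_cast h3
  -- One average serves both demands. The mean of `m * Z` is `n`. Each failing `T` contributes at
  -- least 1 to the inner sum, whose mean is at most `1 / 4` per vertex: in the exponent `M + 2 * t
  -- + 2`, the `M` cancels `2 ^ M`, the `2 * t` pays for the choice of `T`, and the 2 leaves `1 /
  -- 4`.
  have hsum : ∑ ω ∈ Ωs, ((m : ℝ) * Z ω + 4 * ∑ v : V, ∑ T ∈ P.powersetCard t,
      2 ^ M * (1 / 2 : ℝ) ^ X v T ω) ≤ ∑ _ω ∈ Ωs, (2 * n : ℝ) := by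
    rw [Finset.sum_add_distrib, ← Finset.mul_sum, ← Finset.mul_sum, hZ, Finset.sum_comm]
    have h1 : ∀ v : V, ∑ ω ∈ Ωs, ∑ T ∈ P.powersetCard t, 2 ^ M * (1 / 2 : ℝ) ^ X v T ω ≤
        Ωs.card / 4 := by
      intro v
      rw [Finset.sum_comm]
      calc ∑ T ∈ P.powersetCard t, ∑ ω ∈ Ωs, 2 ^ M * (1 / 2 : ℝ) ^ X v T ω
          ≤ ∑ T ∈ P.powersetCard t, (2 : ℝ) ^ M * ((Ωs.card : ℝ) * (1 / 2) ^ (M + 2 * t + 2)) := by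
            refine Finset.sum_le_sum fun T hT => ?_
            rw [← Finset.mul_sum]
            exact mul_le_mul_of_nonneg_left (hX v T hT) (by positivity)
        _ = (P.powersetCard t).card * ((2 : ℝ) ^ M * ((Ωs.card : ℝ) * (1 / 2) ^ (M + 2 * t + 2))) := by
            rw [Finset.sum_const, nsmul_eq_mul]
        _ ≤ 2 ^ (2 * t) * ((2 : ℝ) ^ M * ((Ωs.card : ℝ) * (1 / 2) ^ (M + 2 * t + 2))) := by
            gcongr
            rw [Finset.card_powersetCard, hP]
            exact_mod_cast Nat.choose_le_two_pow (2 * t) t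
        _ = Ωs.card / 4 := by
            rw [pow_add, pow_add, one_div, inv_pow, inv_pow]
            field_simp
            norm_num
    have h2 : ∑ v : V, ∑ ω ∈ Ωs, ∑ T ∈ P.powersetCard t, 2 ^ M * (1 / 2 : ℝ) ^ X v T ω ≤
        n * (Ωs.card / 4) := by
      refine (Finset.sum_le_sum fun v _ => h1 v).trans (le_of_eq ?_)
      simp [hn]
    rw [Finset.sum_const, nsmul_eq_mul]
    linarith
  obtain ⟨ω, hω, hle⟩ := Finset.exists_le_of_sum_le hΩs0 hsum
  have hnn : ∀ v, (0 : ℝ) ≤ ∑ T ∈ P.powersetCard t, 2 ^ M * (1 / 2 : ℝ) ^ X v T ω :=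
    fun v => Finset.sum_nonneg fun T _ => by positivity
  refine ⟨Finset.univ.filter fun v => (ω v).1 = 0, fun v => (ω v).2, fun v => ?_, ?_, ?_⟩
  · exact (Finset.mem_product.1 (Fintype.mem_piFinset.1 hω v)).2
  · have := Finset.sum_nonneg fun v (_ : v ∈ Finset.univ) => hnn v
    have h : (m : ℝ) * Z ω ≤ 2 * n := by linarith
    exact_mod_cast h
  · set bad := Finset.univ.filter fun v => ∃ T ∈ P.powersetCard t,
        ((G.neighborFinset v).filter fun u =>
          u ∈ Finset.univ.filter (fun v => (ω v).1 = 0) ∧ (ω u).2 ⊆ T).card < M with hbad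
    have h1 : (bad.card : ℝ) ≤ ∑ v : V, ∑ T ∈ P.powersetCard t,
        2 ^ M * (1 / 2 : ℝ) ^ X v T ω := by
      rw [Finset.card_eq_sum_ones, Nat.cast_sum]
      refine le_trans ?_ (Finset.sum_le_sum_of_subset_of_nonneg (Finset.subset_univ bad)
        fun v _ _ => hnn v)
      refine Finset.sum_le_sum fun v hv => ?_
      obtain ⟨T, hT, hlt⟩ := (Finset.mem_filter.1 hv).2
      refine le_trans ?_ (Finset.single_le_sum (f := fun T => 2 ^ M * (1 / 2 : ℝ) ^ X v T ω)
        (fun T _ => by positivity) hT)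
      have hXM : X v T ω ≤ M := by
        simp only [Finset.mem_filter, Finset.mem_univ, true_and] at hlt
        exact hlt.le
      have h2 : (1 / 2 : ℝ) ^ M ≤ (1 / 2 : ℝ) ^ X v T ω :=
        pow_le_pow_of_le_one (by norm_num) (by norm_num) hXM
      calc ((1 : ℕ) : ℝ) = 2 ^ M * (1 / 2) ^ M := by rw [← mul_pow]; norm_num
        _ ≤ _ := by gcongr
    have h2 : (0 : ℝ) ≤ m * Z ω := by positivity
    have h3 : 2 * (bad.card : ℝ) ≤ n := by linarith
    exact_mod_cast h3

/-- For a fixed `ψ` and random lists, the count `X` of vertices with `L v ⊆ H ψ v` has mean of `2 ^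
(-X)` at most `exp (-n / 2 ^ (k + 4))`. Half of this exponent pays for the union over `Ψ`; the other
half, with `exp (-X) ≤ 2 ^ (-X)`, gives `X ≥ n / 2 ^ (k + 5)` for all `ψ` at once. -/
theorem exists_lists_subset {ι : Type*} {P : Finset α} {k t : ℕ} (W : Finset V)
    (Ψ : Finset ι) (H : ι → V → Finset α) (hP : P.card = 2 * t) (hkt : 2 * k ^ 2 ≤ t)
    (hW : Fintype.card V ≤ 4 * W.card)
    (hΨ : (Ψ.card : ℝ) < Real.exp (Fintype.card V / 2 ^ (k + 5)))
    (hHP : ∀ ψ ∈ Ψ, ∀ v ∈ W, H ψ v ⊆ P) (hHt : ∀ ψ ∈ Ψ, ∀ v ∈ W, t ≤ (H ψ v).card) :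
    ∃ L : V → Finset α, (∀ v, L v ∈ P.powersetCard k) ∧ ∀ ψ ∈ Ψ,
      Fintype.card V ≤ 2 ^ (k + 5) * (W.filter fun v => L v ⊆ H ψ v).card := by
  set n := Fintype.card V
  set Ωs : Finset (V → Finset α) := Fintype.piFinset fun _ : V => P.powersetCard k with hΩs
  have hk2t : k ≤ 2 * t := by nlinarith
  have hΩs0 : Ωs.Nonempty := by
    rw [hΩs, Fintype.piFinset_nonempty]
    exact fun _ => Finset.powersetCard_nonempty.2 (by omega)
  have hX : ∀ ψ ∈ Ψ, ∑ L ∈ Ωs, (1 / 2 : ℝ) ^ (W.filter fun v => L v ⊆ H ψ v).card ≤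
      Ωs.card * Real.exp (-(n / 2 ^ (k + 4))) := by
    intro ψ hψ
    refine (sum_half_pow_card_filter_le (P.powersetCard k) W (fun v A => A ⊆ H ψ v)
      (x := 1 / 2 ^ (k + 1)) ?_).trans ?_
    · intro v hv
      rw [div_mul_eq_mul_div, one_mul, div_le_iff₀ (by positivity), mul_comm]
      exact_mod_cast card_le_two_pow_mul_card_filter_subset (hHP ψ hψ v hv) hP hkt (hHt ψ hψ v hv)
    · gcongr
      have : (n : ℝ) ≤ 4 * W.card := by exact_mod_cast hW
      rw [div_div, div_mul_eq_mul_div, one_mul, div_le_div_iff₀ (by positivity) (by positivity)]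
      have h2 : (0 : ℝ) < 2 ^ k := by positivity
      rw [pow_add, pow_add]
      nlinarith
  have hsum : ∑ L ∈ Ωs, ∑ ψ ∈ Ψ, (1 / 2 : ℝ) ^ (W.filter fun v => L v ⊆ H ψ v).card <
      ∑ _L ∈ Ωs, Real.exp (-(n / 2 ^ (k + 5))) := by
    rw [Finset.sum_comm, Finset.sum_const, nsmul_eq_mul]
    refine (Finset.sum_le_sum hX).trans_lt ?_
    rw [Finset.sum_const, nsmul_eq_mul]
    have hpos : (0 : ℝ) < Ωs.card * Real.exp (-(n / 2 ^ (k + 4))) := by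
      have : (0 : ℝ) < Ωs.card := by exact_mod_cast Finset.card_pos.2 hΩs0
      positivity
    refine (mul_lt_mul_of_pos_right hΨ hpos).trans_le (le_of_eq ?_)
    rw [mul_left_comm, ← Real.exp_add]
    congr 2
    rw [pow_succ 2 (k + 4)]
    field_simp; norm_num
  obtain ⟨L, hL, hlt⟩ := Finset.exists_lt_of_sum_lt hsum
  refine ⟨L, fun v => Fintype.mem_piFinset.1 hL v, fun ψ hψ => ?_⟩
  by_contra! hc
  have h1 := Finset.single_le_sum
    (f := fun ψ => (1 / 2 : ℝ) ^ (W.filter fun v => L v ⊆ H ψ v).card)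
    (fun ψ _ => by positivity) hψ
  have h2 := (exp_neg_natCast_le _).trans (h1.trans hlt.le)
  rw [Real.exp_le_exp, neg_le_neg_iff, div_le_iff₀ (by positivity)] at h2
  have h3 : ((2 ^ (k + 5) * (W.filter fun v => L v ⊆ H ψ v).card : ℕ) : ℝ) < n := by
    exact_mod_cast hc
  push_cast at h3
  linarith

omit [Fintype V] [DecidableEq V] in
-- Edges between `Y` and `B` are counted from their end in `Y`; disjointness prevents counting an
-- edge from both ends.
theorem card_mul_le_card_edgeFinset_within (G : SimpleGraph V) [DecidableRel G.Adj]
    {S : Set V} [Fintype (G.within S).edgeSet] {B Y : Finset V} {r : ℕ} (hYB : Disjoint Y B)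
    (hY : ∀ v ∈ Y, v ∈ S) (N : V → Finset V)
    (hN : ∀ v ∈ Y, ∀ u ∈ N v, G.Adj v u ∧ u ∈ B ∧ u ∈ S) (hr : ∀ v ∈ Y, r ≤ (N v).card) :
    Y.card * r ≤ (G.within S).edgeFinset.card := by
  calc Y.card * r ≤ ∑ v ∈ Y, (N v).card := by
        rw [← smul_eq_mul]; exact Finset.card_nsmul_le_sum _ _ _ hr
    _ = (Y.sigma N).card := (Finset.card_sigma _ _).symm
    _ ≤ _ := by
      refine Finset.card_le_card_of_injOn (fun p => s(p.1, p.2)) ?_ ?_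
      · rintro ⟨v, u⟩ hp
        simp only [Finset.coe_sigma, Set.mem_sigma_iff, Finset.mem_coe] at hp
        simp only [Finset.mem_coe, mem_edgeFinset, mem_edgeSet]
        have := hN v hp.1 u hp.2
        exact ⟨this.1, hY v hp.1, this.2.2⟩
      · rintro ⟨v, u⟩ hp ⟨v', u'⟩ hp' heq
        simp only [Finset.coe_sigma, Set.mem_sigma_iff, Finset.mem_coe] at hp hp'
        rcases Sym2.eq_iff.1 heq with ⟨h1, h2⟩ | ⟨h1, h2⟩
        · simp only at h1 h2; subst h1; subst h2; rfl
        · simp only at h1 h2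
          exact absurd (h1 ▸ (hN v' hp'.1 u' hp'.2).2.1) (Finset.disjoint_left.1 hYB hp.1)

/-- A graph of large minimum degree has a `k`-list assignment for which every list colouring has a
colour class spanning many edges. -/
theorem exists_lists_forall_exists_dense (G : SimpleGraph V) [DecidableRel G.Adj] [Infinite α]
    [Nonempty V] {k : ℕ} (hG : 2 ^ 21 * 8 ^ k * (k + 1) ^ 5 ≤ G.minDegree)
    [∀ S : Set V, Fintype (G.within S).edgeSet] :
    ∃ L : V → Finset α, (∀ v, (L v).card = k) ∧ ∀ φ : V → α, (∀ v, φ v ∈ L v) →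
      ∃ i, 7 * Fintype.card V ≤ (G.within {v | φ v = i}).edgeFinset.card := by
  set n := Fintype.card V with hn
  -- `t` meets `2 * k ^ 2 ≤ t`; `m` makes `B` so sparse that its `k ^ |B|` colourings number fewer
  -- than `exp (n / 2 ^ (k + 5))`; `r` makes `n / 2 ^ (k + 5)` vertices with `r` edges each yield `7
  -- * n` edges for each of the `2 * t` colours.
  set t := 2 * (k + 1) ^ 2 with ht
  set m := (k + 1) * 2 ^ (k + 7) with hm
  set r := 7 * (2 * t) * 2 ^ (k + 5) with hr
  have ht0 : 2 ≤ t := by rw [ht]; nlinarith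
  have hkt : 2 * k ^ 2 ≤ t := by rw [ht]; gcongr; omega
  have hm128 : 128 ≤ m := by
    have : 2 ^ 7 ≤ 2 ^ (k + 7) := Nat.pow_le_pow_right (by norm_num) (by omega)
    rw [hm]; nlinarith
  obtain ⟨P, hP⟩ := Infinite.exists_subset_card_eq α (2 * t)
  have hP0 : P.Nonempty := Finset.card_pos.1 (by omega)
  obtain ⟨a₀, ha₀⟩ := hP0
  obtain ⟨B, L₀, hL₀, hB, hbad⟩ := G.exists_sample (M := r * t) hP hkt (show 0 < m by omega) (by
    intro v
    refine le_trans ?_ (hG.trans (G.minDegree_le_degree v))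
    have h1 : r * t + 2 * t + 2 ≤ 2 * (r * t) := by
      have : 4 ≤ r := by
        have : 0 < 2 ^ (k + 5) := by positivity
        rw [hr]; nlinarith
      nlinarith
    calc m * 2 ^ (k + 2) * (r * t + 2 * t + 2) ≤ m * 2 ^ (k + 2) * (2 * (r * t)) := by gcongr
      _ = 7 * (2 ^ 18 * ((2 ^ k) ^ 3 * (k + 1) ^ 5)) := by
        rw [hm, hr, ht]; ring
      _ ≤ 8 * (2 ^ 18 * ((2 ^ k) ^ 3 * (k + 1) ^ 5)) := by gcongr; norm_num
      _ = 2 ^ 21 * 8 ^ k * (k + 1) ^ 5 := by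
        rw [show (8 : ℕ) ^ k = (2 ^ k) ^ 3 by rw [← pow_mul, mul_comm, pow_mul]; norm_num]
        ring)
  set bad := Finset.univ.filter fun v => ∃ T ∈ P.powersetCard t,
    ((G.neighborFinset v).filter fun u => u ∈ B ∧ L₀ u ⊆ T).card < r * t with hbad_def
  set W := Finset.univ \ (bad ∪ B) with hWdef
  -- At most half of the vertices are bad, and `B` contains at most a 64th.
  have hWcard : n ≤ 4 * W.card := by
    have h1 : n - (bad ∪ B).card ≤ W.card := by
      rw [hWdef, hn, ← Finset.card_univ]; exact Finset.le_card_sdiff _ _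
    have h2 := Finset.card_union_le bad B
    have h3 : 128 * B.card ≤ 2 * n := le_trans (by gcongr) hB
    omega
  -- The list colourings of `B`; the dummy value `a₀` elsewhere keeps their number at `k ^ |B|`.
  set Ψ : Finset (V → α) := Fintype.piFinset fun v => if v ∈ B then L₀ v else {a₀} with hΨ
  let H : (V → α) → V → Finset α := fun ψ v =>
    P.filter fun c => r ≤ ((G.neighborFinset v).filter fun u => u ∈ B ∧ ψ u = c).card
  have hΨcard : Ψ.card = k ^ B.card := by
    rw [hΨ, Fintype.card_piFinset]
    have : ∀ v, (if v ∈ B then L₀ v else {a₀}).card = if v ∈ B then k else 1 := by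
      intro v
      split_ifs
      · exact (Finset.mem_powersetCard.1 (hL₀ v)).2
      · simp
    simp_rw [this]
    rw [Finset.prod_ite_mem, Finset.univ_inter, Finset.prod_const]
  have hn0 : 0 < n := Fintype.card_pos
  obtain ⟨L₁, hL₁, hmany⟩ := exists_lists_subset (P := P) (k := k) (t := t) W Ψ H hP hkt hWcard
    (by
      rw [hΨcard]
      have h1 : (k : ℝ) ≤ Real.exp k := by
        have := Real.add_one_le_exp (k : ℝ); linarith
      push_cast
      refine (pow_le_pow_left₀ (Nat.cast_nonneg k) h1 _).trans_lt ?_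
      rw [← Real.exp_nat_mul, Real.exp_lt_exp, lt_div_iff₀ (by positivity)]
      have h2 : (m : ℝ) * B.card ≤ 2 * n := by exact_mod_cast hB
      rw [hm] at h2
      push_cast at h2
      have h3 : (0 : ℝ) < n := by exact_mod_cast hn0
      have h4 : (0 : ℝ) ≤ B.card * 2 ^ (k + 5) := by positivity
      have h5 : (2 : ℝ) ^ (k + 7) = 4 * 2 ^ (k + 5) := by ring
      rw [h5] at h2
      nlinarith)
    (fun ψ _ v _ => Finset.filter_subset _ _)
    (by
      intro ψ hψ v hv
      -- Otherwise some `t` colours `T` each occur fewer than `r` times on the neighbours of `v` in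
      -- `B`. But `v` is not bad, so at least `r * t` of these neighbours have lists inside `T` and
      -- must take their colours there.
      by_contra! hlt
      have hcard : t ≤ (P \ H ψ v).card := by
        have := Finset.le_card_sdiff (H ψ v) P
        omega
      obtain ⟨T, hTsub, hTc⟩ := Finset.exists_subset_card_eq hcard
      have hvb : v ∉ bad := fun h => by simp [hWdef, h] at hv
      have hM : r * t ≤ ((G.neighborFinset v).filter fun u => u ∈ B ∧ L₀ u ⊆ T).card := by
        by_contra! h
        exact hvb (Finset.mem_filter.2 ⟨Finset.mem_univ _, T,
          Finset.mem_powersetCard.2 ⟨hTsub.trans Finset.sdiff_subset, hTc⟩, h⟩)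
      have hr0 : 0 < r := by
        have : 0 < 2 ^ (k + 5) := by positivity
        rw [hr]; positivity
      have hle := Finset.card_le_mul_card_image_of_maps_to
        (s := (G.neighborFinset v).filter fun u => u ∈ B ∧ L₀ u ⊆ T) (f := ψ) (t := T) (by
          intro u hu
          obtain ⟨-, huB, huT⟩ := Finset.mem_filter.1 hu
          have := Fintype.mem_piFinset.1 hψ u
          rw [if_pos huB] at this
          exact huT this) (r - 1) (by
          intro c hc
          have hcH := Finset.mem_sdiff.1 (hTsub hc)
          have h1 : ((G.neighborFinset v).filter fun u => u ∈ B ∧ ψ u = c).card < r := by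
            by_contra! h
            exact hcH.2 (Finset.mem_filter.2 ⟨hcH.1, h⟩)
          refine Nat.le_sub_one_of_lt (lt_of_le_of_lt (Finset.card_le_card ?_) h1)
          intro u hu
          simp only [Finset.mem_filter] at hu ⊢
          exact ⟨hu.1.1, hu.1.2.1, hu.2⟩)
      rw [hTc] at hle
      have h1 : (r - 1) * t < r * t := Nat.mul_lt_mul_of_pos_right (by omega) (by omega)
      omega)
  refine ⟨fun v => if v ∈ B then L₀ v else L₁ v, fun v => ?_, fun φ hφ => ?_⟩
  · dsimp only
    split_ifs
    · exact (Finset.mem_powersetCard.1 (hL₀ v)).2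
    · exact (Finset.mem_powersetCard.1 (hL₁ v)).2
  · set ψ : V → α := fun v => if v ∈ B then φ v else a₀ with hψdef
    have hψ : ψ ∈ Ψ := by
      rw [hΨ, Fintype.mem_piFinset]
      intro v
      have := hφ v
      by_cases hv : v ∈ B
      · simpa [hψdef, hv] using this
      · simp [hψdef, hv]
    have hYn := hmany ψ hψ
    set Y := W.filter fun v => L₁ v ⊆ H ψ v with hY
    have hYB : ∀ v ∈ Y, v ∉ B := fun v hv hvB => by
      have := (Finset.mem_filter.1 hv).1
      simp [hWdef, hvB] at this
    have hYH : ∀ v ∈ Y, φ v ∈ H ψ v := fun v hv => by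
      have := hφ v
      simp only [if_neg (hYB v hv)] at this
      exact (Finset.mem_filter.1 hv).2 this
    have hc : ∀ c ∈ P, (Y.filter fun v => φ v = c).card * r ≤
        (G.within {v | φ v = c}).edgeFinset.card := by
      intro c _
      refine G.card_mul_le_card_edgeFinset_within (B := B) ?_ ?_
        (fun v => (G.neighborFinset v).filter fun u => u ∈ B ∧ ψ u = c) ?_ ?_
      · rw [Finset.disjoint_left]
        exact fun v hv => hYB v (Finset.mem_filter.1 hv).1
      · exact fun v hv => (Finset.mem_filter.1 hv).2
      · intro v _ u hu
        simp only [Finset.mem_filter, mem_neighborFinset] at hu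
        refine ⟨hu.1, hu.2.1, ?_⟩
        have := hu.2.2
        rw [hψdef] at this
        simpa [hu.2.1] using this
      · intro v hv
        obtain ⟨hvY, hvc⟩ := Finset.mem_filter.1 hv
        have := (Finset.mem_filter.1 (hYH v hvY)).2
        rwa [hvc] at this
    have hsum : Y.card = ∑ c ∈ P, (Y.filter fun v => φ v = c).card :=
      Finset.card_eq_sum_card_fiberwise fun v hv => (Finset.mem_filter.1 (hYH v hv)).1
    -- Pigeonhole over the palette: the vertices of `Y` together have at least `2 * t * (7 * n)`
    -- edges to `B` in their own colour.
    obtain ⟨c, -, h⟩ := Finset.exists_le_of_sum_le ⟨a₀, ha₀⟩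
      (show ∑ _c ∈ P, 7 * n ≤ ∑ c ∈ P, (G.within {v | φ v = c}).edgeFinset.card by
        refine le_trans ?_ (Finset.sum_le_sum hc)
        rw [← Finset.sum_mul P _ r, ← hsum, Finset.sum_const, smul_eq_mul, hP, hr]
        calc 2 * t * (7 * n) ≤ 2 * t * (7 * (2 ^ (k + 5) * Y.card)) := by gcongr
          _ = _ := by ring)
    exact ⟨c, h⟩

end SimpleGraph

/-! ### From dense colour classes to dichoosability -/

open Classical in
/-- Almost all orientations of a graph of large minimum degree have dichoosability above `k`. -/
theorem Digraph.le_ncard_lt_dichoosability {V : Type u} [Fintype V] (G : SimpleGraph V)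
    [DecidableRel G.Adj] {k : ℕ} (hG : 2 ^ 21 * 8 ^ k * (k + 1) ^ 5 ≤ G.minDegree) :
    (1 - (1 / 2 : ℝ) ^ G.minDegree) * ({D : Digraph V | D.IsOrientationOf G}.ncard : ℝ) ≤
      ({D : Digraph V | D.IsOrientationOf G ∧ k < D.dichoosability}.ncard : ℝ) := by
  have hd : 0 < G.minDegree := lt_of_lt_of_le (by positivity) hG
  have hV : Nonempty V := by
    by_contra h
    rw [not_nonempty_iff] at h
    simp at hd
  obtain ⟨L, hL, hdense⟩ := G.exists_lists_forall_exists_dense (α := ℕ+) hG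
  set n := Fintype.card V with hn
  set N := {D : Digraph V | D.IsOrientationOf G}.ncard
  have hbad := Digraph.ncard_exists_isAcyclic_dense_mul_le G
  set bad := {D : Digraph V | D.IsOrientationOf G ∧ ∃ S : Set V, (D.inducedOn S).IsAcyclic ∧
        7 * Fintype.card V ≤ (G.within S).edgeFinset.card}
  set good := {D : Digraph V | D.IsOrientationOf G ∧ k < D.dichoosability}
  have hsub : {D : Digraph V | D.IsOrientationOf G} ⊆ bad ∪ good := by
    intro D hD
    by_cases hk : k < D.dichoosability
    · exact Or.inr ⟨hD, hk⟩
    · left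
      have hloop : ∀ v, ¬ D.Adj v v := fun v hv => hD.not_both v v ⟨hv, hv⟩
      obtain ⟨φ, hφ, hac⟩ := D.isDichoosable_dichoosability hloop L fun v => by
        rw [hL v]; omega
      obtain ⟨i, hi⟩ := hdense φ hφ
      exact ⟨hD, {v | φ v = i}, hac i, by convert hi⟩
  have hN : N ≤ bad.ncard + good.ncard :=
    (Set.ncard_le_ncard hsub (Set.toFinite _)).trans (Set.ncard_union_le _ _)
  have hdn : G.minDegree ≤ n := G.minDegree_lt_card.le
  have hb : (bad.ncard : ℝ) ≤ (1 / 2 : ℝ) ^ G.minDegree * N := by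
    have h1 : (bad.ncard : ℝ) * 2 ^ n ≤ N := by exact_mod_cast hbad
    have h2 : (1 / 2 : ℝ) ^ n ≤ (1 / 2 : ℝ) ^ G.minDegree :=
      pow_le_pow_of_le_one (by norm_num) (by norm_num) hdn
    calc (bad.ncard : ℝ) = (1 / 2) ^ n * (bad.ncard * 2 ^ n) := by
          rw [mul_left_comm, ← mul_pow]; norm_num
      _ ≤ (1 / 2) ^ n * N := by gcongr
      _ ≤ _ := by gcongr
  have hN' : (N : ℝ) ≤ bad.ncard + good.ncard := by exact_mod_cast hN
  linarith

/-- The error term is chosen so that `8 ^ x ≤ d / (logb 2 d) ^ 6` for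
`x = (1 / 3 - ε d) * logb 2 d`. -/
theorem exists_error_term : ∃ ε : ℕ → ℝ, Filter.Tendsto ε Filter.atTop (nhds 0) ∧
    ∀ d : ℕ, (1 / 3 - ε d) * Real.logb 2 d ≤ 0 ∨
      ∃ k : ℕ, 2 ^ 21 * 8 ^ k * (k + 1) ^ 5 ≤ d ∧
        (1 / 3 - ε d) * Real.logb 2 d ≤ (k + 1 : ℕ) := by
  let ℓ : ℕ → ℝ := fun d => Real.logb 2 d
  have hℓ : Filter.Tendsto ℓ Filter.atTop Filter.atTop :=
    (Real.tendsto_logb_atTop (by norm_num)).comp tendsto_natCast_atTop_atTop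
  -- For small `d` the value `1 / 3` makes the bound trivial. Otherwise `8 ^ x * ℓ d ^ 6 = d`: one
  -- factor `ℓ d` absorbs `2 ^ 21`, the other five absorb `(k + 1) ^ 5`.
  refine ⟨fun d => if ℓ d < 2 ^ 21 then 1 / 3 else 2 * (Real.logb 2 (ℓ d) / ℓ d), ?_, ?_⟩
  · have h1 : Filter.Tendsto (fun x : ℝ => Real.logb 2 x / x) Filter.atTop (nhds 0) := by
      have := (Real.isLittleO_log_id_atTop.tendsto_div_nhds_zero).div_const (Real.log 2)
      rw [zero_div] at this
      refine this.congr fun x => ?_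
      simp only [Real.logb, id]; ring
    have h2 := (h1.comp hℓ).const_mul 2
    rw [mul_zero] at h2
    refine h2.congr' ?_
    filter_upwards [hℓ.eventually_ge_atTop (2 ^ 21)] with d hd
    rw [if_neg (not_lt.2 hd)]; rfl
  · intro d
    by_cases hd : ℓ d < 2 ^ 21
    · left; simp [hd]
    · simp only [if_neg hd]
      rw [not_lt] at hd
      change (1 / 3 - 2 * (Real.logb 2 (ℓ d) / ℓ d)) * ℓ d ≤ 0 ∨
        ∃ k : ℕ, _ ∧ (1 / 3 - 2 * (Real.logb 2 (ℓ d) / ℓ d)) * ℓ d ≤ _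
      have hpos : 0 < ℓ d := lt_of_lt_of_le (by positivity) hd
      have hx : (1 / 3 - 2 * (Real.logb 2 (ℓ d) / ℓ d)) * ℓ d =
          ℓ d / 3 - 2 * Real.logb 2 (ℓ d) := by field_simp
      rw [hx]
      set x := ℓ d / 3 - 2 * Real.logb 2 (ℓ d) with hxdef
      have hd0 : (0 : ℝ) < d := by
        rcases Nat.eq_zero_or_pos d with h | h
        · simp [ℓ, h] at hpos
        · exact_mod_cast h
      have hlog : 0 ≤ Real.logb 2 (ℓ d) :=
        Real.logb_nonneg (by norm_num) (le_trans (by norm_num) hd)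
      have hexp : (2 : ℝ) ^ (3 * x) * ℓ d ^ 6 = d := by
        have h1 : 3 * x = ℓ d - Real.logb 2 (ℓ d) * (6 : ℕ) := by rw [hxdef]; push_cast; ring
        have h2 : (2 : ℝ) ^ Real.logb 2 (ℓ d) = ℓ d :=
          Real.rpow_logb (by norm_num) (by norm_num) hpos
        have h3 : (2 : ℝ) ^ ℓ d = d := Real.rpow_logb (by norm_num) (by norm_num) hd0
        rw [h1, Real.rpow_sub (by norm_num), h3, Real.rpow_mul (by norm_num), Real.rpow_natCast,
          h2, div_mul_cancel₀ _ (by positivity)]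
      rcases le_or_gt x 0 with hx0 | hx0
      · exact Or.inl hx0
      right
      -- Dichoosability above `k` means at least `k + 1`, so rounding `x` down loses nothing.
      refine ⟨⌊x⌋₊, ?_, by push_cast; exact (Nat.lt_floor_add_one x).le⟩
      have hk : (⌊x⌋₊ : ℝ) ≤ x := Nat.floor_le hx0.le
      have h8 : (8 : ℝ) ^ ⌊x⌋₊ ≤ 2 ^ (3 * x) := by
        calc (8 : ℝ) ^ ⌊x⌋₊ = 2 ^ (3 * (⌊x⌋₊ : ℝ)) := by
              rw [Real.rpow_mul (by norm_num), Real.rpow_natCast]; norm_num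
          _ ≤ 2 ^ (3 * x) := Real.rpow_le_rpow_of_exponent_le (by norm_num) (by linarith)
      have hkℓ : (⌊x⌋₊ : ℝ) + 1 ≤ ℓ d := by
        have : (2 : ℝ) ^ 21 ≤ ℓ d := hd
        norm_num at this
        linarith
      have : (2 : ℝ) ^ 21 * 8 ^ ⌊x⌋₊ * (⌊x⌋₊ + 1) ^ 5 ≤ d := by
        calc (2 : ℝ) ^ 21 * 8 ^ ⌊x⌋₊ * (⌊x⌋₊ + 1) ^ 5
            ≤ ℓ d * 2 ^ (3 * x) * ℓ d ^ 5 := by gcongr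
          _ = 2 ^ (3 * x) * ℓ d ^ 6 := by ring
          _ = d := hexp
      exact_mod_cast this

theorem theorem1 :
    (∃ ε : ℕ → ℝ, Filter.Tendsto ε Filter.atTop (nhds 0) ∧
      ∀ (V : Type u) [Fintype V] (G : SimpleGraph V) [DecidableRel G.Adj],
        ∃ D : Digraph V, D.IsOrientationOf G ∧
          (1 / 3 - ε G.minDegree) * Real.logb 2 (G.minDegree : ℝ) ≤ (D.dichoosability : ℝ)) ∧
    (∃ c : ℝ, 0 < c ∧ ∀ η : ℝ, 0 < η → ∃ d₀ : ℕ,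
      ∀ (V : Type u) [Fintype V] (G : SimpleGraph V) [DecidableRel G.Adj],
        d₀ ≤ G.minDegree →
          (1 - η) * ({D : Digraph V | D.IsOrientationOf G}.ncard : ℝ) ≤
            ({D : Digraph V | D.IsOrientationOf G ∧
              c * Real.log (G.minDegree : ℝ) ≤ (D.dichoosability : ℝ)}.ncard : ℝ)) := by
  obtain ⟨ε, hε, hεk⟩ := exists_error_term
  have main : ∀ (V : Type u) [Fintype V] (G : SimpleGraph V) [DecidableRel G.Adj],
      (1 - (1 / 2 : ℝ) ^ G.minDegree) * ({D : Digraph V | D.IsOrientationOf G}.ncard : ℝ) ≤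
        ({D : Digraph V | D.IsOrientationOf G ∧ (1 / 3 - ε G.minDegree) *
          Real.logb 2 (G.minDegree : ℝ) ≤ (D.dichoosability : ℝ)}.ncard : ℝ) := by
    intro V _ G _
    rcases hεk G.minDegree with h | ⟨k, hk, h⟩
    · have : {D : Digraph V | D.IsOrientationOf G ∧ (1 / 3 - ε G.minDegree) *
          Real.logb 2 (G.minDegree : ℝ) ≤ (D.dichoosability : ℝ)} =
          {D : Digraph V | D.IsOrientationOf G} := by
        ext D
        exact ⟨fun hD => hD.1, fun hD => ⟨hD, h.trans (Nat.cast_nonneg _)⟩⟩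
      rw [this]
      have h0 : (0 : ℝ) ≤ (1 / 2 : ℝ) ^ G.minDegree := by positivity
      exact mul_le_of_le_one_left (Nat.cast_nonneg _) (by linarith)
    · refine (Digraph.le_ncard_lt_dichoosability G hk).trans ?_
      refine Nat.cast_le.2 (Set.ncard_le_ncard (fun D hD => ⟨hD.1, h.trans ?_⟩) (Set.toFinite _))
      exact Nat.cast_le.2 hD.2
  constructor
  · refine ⟨ε, hε, fun V _ G _ => ?_⟩
    obtain ⟨D₀, hD₀⟩ := Digraph.exists_isOrientationOf G
    -- In degree 0 the proportion `1 - (1 / 2) ^ 0` vanishes and yields no orientation, but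
    -- `Real.logb 2 0 = 0` makes any orientation suffice.
    rcases Nat.eq_zero_or_pos G.minDegree with h0 | h0
    · exact ⟨D₀, hD₀, by simp [h0]⟩
    · have hN : (0 : ℝ) < {D : Digraph V | D.IsOrientationOf G}.ncard := by
        exact_mod_cast (Set.ncard_pos (Set.toFinite _)).2 ⟨D₀, hD₀⟩
      have h1 : (1 / 2 : ℝ) ^ G.minDegree < 1 :=
        pow_lt_one₀ (by norm_num) (by norm_num) h0.ne'
      have h2 := (mul_pos (sub_pos.2 h1) hN).trans_le (main V G)
      exact (Set.ncard_pos (Set.toFinite _)).1 (by exact_mod_cast h2)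
  -- Once `ε d < 1 / 6` the coefficient `1 / 3 - ε d` exceeds `1 / 6`, and the binary logarithm
  -- dominates the natural one.
  · refine ⟨1 / 6, by norm_num, fun η hη => ?_⟩
    have e1 : ∀ᶠ d : ℕ in Filter.atTop, (1 / 2 : ℝ) ^ d < η :=
      (tendsto_pow_atTop_nhds_zero_of_lt_one (by norm_num) (by norm_num)).eventually_lt_const hη
    have e2 : ∀ᶠ d : ℕ in Filter.atTop, ε d < 1 / 6 := hε.eventually_lt_const (by norm_num)
    obtain ⟨d₀, hd₀⟩ := Filter.eventually_atTop.1 (e1.and e2)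
    refine ⟨d₀, fun V _ G _ hG => ?_⟩
    obtain ⟨h1, h2⟩ := hd₀ _ hG
    refine le_trans ?_ ((main V G).trans ?_)
    · gcongr
    · have hlog : 1 / 6 * Real.log (G.minDegree : ℝ) ≤
          (1 / 3 - ε G.minDegree) * Real.logb 2 (G.minDegree : ℝ) := by
        have h3 : 0 ≤ Real.log (G.minDegree : ℝ) := Real.log_natCast_nonneg _
        have h4 : Real.log (G.minDegree : ℝ) ≤ Real.logb 2 (G.minDegree : ℝ) := by
          rw [Real.logb, le_div_iff₀ (Real.log_pos (by norm_num))]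
          have : Real.log 2 ≤ 1 := by
            have := Real.log_le_sub_one_of_pos (x := 2) (by norm_num); linarith
          nlinarith
        have h5 : 0 ≤ Real.logb 2 (G.minDegree : ℝ) := h3.trans h4
        nlinarith
      exact Nat.cast_le.2
        (Set.ncard_le_ncard (fun D hD => ⟨hD.1, hlog.trans hD.2⟩) (Set.toFinite _))
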